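/- Let $\kappa$ be a strongly inaccessible (uncountable) cardinal. Let $S\subseteq\kappa$ be a non-reflecting stationary set, i.e. $S$ is stationary in $\kappa$ and $S\cap\gamma$ is not stationary in $\gamma$ for every $\gamma<\kappa$ of uncountable cofinality. Suppose that $\diamondsuit_S$ holds, i.e. there is a sequence $\langle D_\alpha:\alpha\in S\rangle$ with $D_\alpha\subseteq\alpha$ such that for every $X\subseteq\kappa$ the set $\{\alpha\in S: X\cap\alpha=D_\alpha\}$ is stationary in $\kappa$. Then $\mathrm{HL}^+_{2,\theta}[\kappa]$ fails for every $2\le\theta<\kappa$. Here ${}^{\alpha}2$ is the set of functions from $\alpha$ to $2$, ${}^{\kappa>}2=\bigcup_{\alpha<\kappa}{}^{\alpha}2$, $\lg(\eta)$ is the length (domain) of $\eta$, and $\eta\trianglelefteq\nu$ (respectively $\eta\lhd\nu$) means that $\eta$ is an initial segment (respectively a proper initial segment) of $\nu$. A regular subtree of ${}^{\kappa>}2$ is a non-empty set $T\subseteq{}^{\kappa>}2$, closed under initial segments, such that (1) for all $\eta\in T$ and $\alpha<\kappa$ there is $\nu\in T$ with $\eta\trianglelefteq\nu$ and $\lg(\nu)=\max\{\lg(\eta),\alpha\}$,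 and (2) if $\delta<\kappa$ is a limit ordinal and $\eta\in{}^{\delta}2$ satisfies $\eta\restriction\alpha\in T$ for all $\alpha<\delta$, then $\eta\in T$. A triple $(\kappa,T,A)$ is suitable if $A\subseteq\kappa$ has cardinality $\kappa$, $T$ is a regular subtree of ${}^{\kappa>}2$, and for every $\eta\in T$ one has $\{\eta^\frown 0,\eta^\frown 1\}\subseteq T$ if and only if $\lg(\eta)\in A$. For $1\le n<\omega$, $\mathrm{HL}^+_{n,\theta}[\kappa]$ is the statement: for every sequence $\langle <_\alpha:\alpha<\kappa\rangle$, where $<_\alpha$ is a well-ordering of ${}^{\alpha}2$, and every coloring $c:\bigcup_{\alpha<\kappa}[{}^{\alpha}2]^n\to\theta$, there is a suitable triple $(\kappa,T,A)$ such that for all $\alpha<\kappa$ and all pairwise distinct $\eta_0,\dots,\eta_{n-1}\in T\cap{}^{\alpha}2$ there is a color in $\theta$ that is different from $c(\{\nu_0,\dots,\nu_{n-1}\})$ for all $\nu_0,\dots,\nu_{n-1}\in T$ with $\eta_\ell\lhd\nu_\ell$ for each $\ell<n$, $\lg(\nu_0)=\dots=\lg(\nu_{n-1})=:\beta\in A$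 and $\nu_0<_\beta\dots<_\beta\nu_{n-1}$. -/

import Mathlib

universe u

namespace HalpernLauchli

/-- `^α 2`: binary sequences of ordinal length `α`. -/
abbrev BinSeq (α : Ordinal.{u}) : Type (u + 1) := Set.Iio α → Bool

namespace BinSeq

/-- The restriction `η ↾ β`, for `β ≤ α`. -/
def restrict {α β : Ordinal.{u}} (h : β ≤ α) (η : BinSeq α) : BinSeq β :=
  fun x => η ⟨x.1, lt_of_lt_of_le x.2 h⟩

open Classical in
/-- The one-step extension `η ⌢ ⟨i⟩`. -/
noncomputable def snoc {α : Ordinal.{u}} (η : BinSeq α) (i : Bool) : BinSeq (α + 1) :=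
  fun x => if h : x.1 < α then η ⟨x.1, h⟩ else i

end BinSeq

/-- Binary sequences of arbitrary ordinal length, tagged with their length. -/
abbrev Node : Type (u + 1) := Σ α : Ordinal.{u}, BinSeq α

namespace Node

/-- The length of a node. -/
abbrev lg (η : Node.{u}) : Ordinal.{u} := η.1

/-- `η ⊴ ν`: `η` is an initial segment of `ν`. -/
def IsInit (η ν : Node.{u}) : Prop :=
  ∃ h : η.lg ≤ ν.lg, BinSeq.restrict h ν.2 = η.2

/-- `η ◁ ν`: `η` is a proper initial segment of `ν`. -/
def IsProperInit (η ν : Node.{u}) : Prop :=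
  IsInit η ν ∧ η ≠ ν

end Node

/-- `^{κ>} 2`: the binary sequences of length less than `κ`. -/
def fullTree (κ : Ordinal.{u}) : Set Node.{u} := {η | η.lg < κ}

/-- `T` is a subtree of `^{κ>} 2`: a non-empty subset closed under initial segments. -/
structure IsSubtree (κ : Ordinal.{u}) (T : Set Node.{u}) : Prop where
  subset : T ⊆ fullTree κ
  nonempty : T.Nonempty
  init_mem : ∀ η ν : Node.{u}, ν ∈ T → Node.IsInit η ν → η ∈ T

/-- `T` is a regular subtree of `^{κ>} 2`. -/
structure IsRegularSubtree (κ : Ordinal.{u}) (T : Set Node.{u}) : Prop extends IsSubtree κ T where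
  exists_extension : ∀ η ∈ T, ∀ α < κ, ∃ ν ∈ T, Node.IsInit η ν ∧ ν.lg = max η.lg α
  limit_mem : ∀ δ < κ, Order.IsSuccLimit δ → ∀ η : BinSeq δ,
    (∀ (α : Ordinal.{u}) (h : α < δ), (⟨α, η.restrict h.le⟩ : Node.{u}) ∈ T) →
      (⟨δ, η⟩ : Node.{u}) ∈ T

/-- `(κ, T, A)` is a suitable triple. -/
structure IsSuitable (κ : Cardinal.{u}) (T : Set Node.{u}) (A : Set Ordinal.{u}) : Prop where
  subset : A ⊆ Set.Iio κ.ord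
  card_eq : Cardinal.mk A = Cardinal.lift.{u + 1} κ
  regular : IsRegularSubtree κ.ord T
  split_iff : ∀ (α : Ordinal.{u}) (η : BinSeq α), (⟨α, η⟩ : Node.{u}) ∈ T →
    ((∀ i : Bool, (⟨α + 1, η.snoc i⟩ : Node.{u}) ∈ T) ↔ α ∈ A)

/-- The principle `HL⁺_{n,θ}[κ]`. A color set `θ` is the set of ordinals below `θ`. An
increasing tuple is injective, so that nothing is lost by letting `ν` range over embeddings;
`Set.powersetCard.ofFinEmb n _ ν` is the `n`-element set `{ν 0, …, ν (n - 1)}`. -/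
def HLPlusBracket (n : ℕ) (θ : Ordinal.{u}) (κ : Cardinal.{u}) : Prop :=
  ∀ lt : ∀ α : Set.Iio κ.ord, BinSeq α.1 → BinSeq α.1 → Prop,
    (∀ α, IsWellOrder (BinSeq α.1) (lt α)) →
  ∀ c : ∀ α : Set.Iio κ.ord, Set.powersetCard (BinSeq α.1) n → Set.Iio θ,
  ∃ (T : Set Node.{u}) (A : Set Ordinal.{u}), IsSuitable κ T A ∧
    ∀ α < κ.ord, ∀ η : Fin n → BinSeq α, Function.Injective η →
      (∀ l, (⟨α, η l⟩ : Node.{u}) ∈ T) →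
      ∃ color : Set.Iio θ, ∀ β : Set.Iio κ.ord, β.1 ∈ A →
        ∀ ν : Fin n ↪ BinSeq β.1,
          (∀ l, Node.IsProperInit ⟨α, η l⟩ ⟨β.1, ν l⟩ ∧ (⟨β.1, ν l⟩ : Node.{u}) ∈ T) →
          (∀ i j, i < j → lt β (ν i) (ν j)) →
          c β (Set.powersetCard.ofFinEmb n _ ν) ≠ color

/-- `S ∩ γ` is a stationary subset of the ordinal `γ`. -/
def StationaryIn (S : Set Ordinal.{u}) (γ : Ordinal.{u}) : Prop :=
  IsStationary {x : Set.Iio γ | x.1 ∈ S}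

/-- `S` does not reflect below `κ`: it is not stationary in any `γ < κ` of uncountable
cofinality. -/
def NonReflecting (S : Set Ordinal.{u}) (κ : Ordinal.{u}) : Prop :=
  ∀ γ < κ, Cardinal.aleph0 < γ.cof → ¬ StationaryIn S γ

/-- The diamond principle `◇_S` for `S ⊆ κ`. -/
def Diamond (κ : Ordinal.{u}) (S : Set Ordinal.{u}) : Prop :=
  ∃ D : Ordinal.{u} → Set Ordinal.{u}, (∀ α ∈ S, D α ⊆ Set.Iio α) ∧
    ∀ X ⊆ Set.Iio κ, StationaryIn {α | α ∈ S ∧ X ∩ Set.Iio α = D α} κ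

end HalpernLauchli

/-! The diamond sequence `D` predicts the splitting levels `A`, and non-reflection makes one
colouring serve all predictions at once. For a limit `δ ∈ S` with `D δ` unbounded, choose an
unbounded ladder `B δ ⊆ D δ` with no accumulation point in `S` below `δ`. For each `β < κ` the
ladders with `δ ≤ β` become disjoint after deleting bounded pieces
(`NonReflecting.exists_disjointing`). So the first difference `ξ` of `x, y` at level `β` determines
at most one `δ` whose trimmed ladder contains it. The colour of an increasing pair `x, y` is then
`col δ` at the last point of `D δ` where `y` is 1, where `col δ` takes every value cofinally in `D
δ` if possible.

Given a suitable `(T, A)`, `exists_guess` finds `δ` with `A ∩ δ = D δ` at which such a `col δ`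
exists. Split `T` at a trimmed ladder point `ξ ∈ A` and fix a level `β ∈ A` with `β ≥ δ`. One of the
two cones has an `x` below the whole other cone, and in that cone the last 1 of `y` on `D δ` can be
placed at will, so every colour occurs. -/

namespace HalpernLauchli

/-! ### Clubs, gaps and disjoint ladders -/

open Cardinal Order Set

/-- The limit points of a cofinal set form a club. -/
theorem isClub_limitPoints {α : Type*} [LinearOrder α] [WellFoundedLT α] [NoMaxOrder α]
    (hα : ℵ₀ < Order.cof α) {s : Set α} (hs : IsCofinal s) :
    IsClub {d : α | (∃ a, a < d) ∧ ∀ a < d, ∃ b ∈ s, a < b ∧ b < d} := by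
  constructor
  · rintro d hd ⟨e, he⟩ - x hx
    refine ⟨?_, fun a ha => ?_⟩
    · obtain ⟨a, ha⟩ := (hd he).1
      exact ⟨a, ha.trans_le (hx.1 he)⟩
    · obtain ⟨e', he', hae⟩ := (lt_isLUB_iff hx).1 ha
      obtain ⟨b, hb, hab, hbe⟩ := (hd he').2 a hae
      exact ⟨b, hb, hab, hbe.trans_le (hx.1 he')⟩
  · intro a
    have key : ∀ x : α, ∃ b ∈ s, x < b := fun x => by
      obtain ⟨y, hy⟩ := exists_gt x
      obtain ⟨b, hb, hyb⟩ := hs y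
      exact ⟨b, hb, hy.trans_le hyb⟩
    choose F hFs hF using key
    let g : ℕ → α := fun n => F^[n] a
    have hg : ∀ n, g (n + 1) = F (g n) := fun n => Function.iterate_succ_apply' F n a
    have hbdd : BddAbove (range g) := by
      refine .of_not_isCofinal fun h => (cof_le h).not_gt (hα.trans_le' ?_)
      simpa using mk_range_le_lift (f := g)
    obtain ⟨x, hx⟩ : ∃ x, IsLUB (range g) x := by
      obtain ⟨m, hm, hmin⟩ := WellFounded.has_min (wellFounded_lt (α := α)) (upperBounds (range g)) hbdd
      exact ⟨m, hm, fun y hy => not_lt.1 (hmin y hy)⟩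
    refine ⟨x, ⟨⟨g 0, ?_⟩, fun c hc => ?_⟩, hx.1 ⟨0, rfl⟩⟩
    · exact (hF (g 0)).trans_le (hg 0 ▸ hx.1 ⟨1, rfl⟩)
    · obtain ⟨_, ⟨n, rfl⟩, hn⟩ := (lt_isLUB_iff hx).1 hc
      refine ⟨g (n + 1), hg n ▸ hFs _, hn.trans (hg n ▸ hF _), ?_⟩
      exact (hF (g (n + 1))).trans_le (hg (n + 1) ▸ hx.1 ⟨n + 2, rfl⟩)

theorem cof_Iio_ord {κ : Cardinal.{u}} (hκ : κ.IsRegular) :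
    Order.cof (Iio κ.ord) = Cardinal.lift.{u + 1} κ := by
  rw [Ordinal.cof_Iio, ← Ordinal.lift_cof, hκ.cof_ord]

/-- A set of full cardinality can be coloured with every colour appearing cofinally. -/
theorem exists_cofinal_colouring {κ : Cardinal.{u}} (hκ : ℵ₀ ≤ κ) {A : Set Ordinal.{u}}
    (hA : #A = Cardinal.lift.{u + 1} κ) {θ : Ordinal.{u}} (hθ : 0 < θ) (hθκ : θ < κ.ord) :
    ∃ h : Ordinal.{u} → Iio θ, ∀ r, ∀ α < κ.ord, ∃ a ∈ A, α < a ∧ h a = r := by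
  -- Colour by the second coordinate of a bijection of `A` with `κ × θ`: each colour class has size
  -- `κ`, too large to lie in `Iic α`.
  have hcard : #A = #(Iio κ.ord × Iio θ) := by
    rw [hA, mk_prod, Cardinal.lift_id, Cardinal.lift_id, mk_Iio_ordinal, mk_Iio_ordinal, card_ord,
      ← Cardinal.lift_mul, Cardinal.mul_eq_left hκ (lt_ord.1 hθκ).le]
    simpa using hθ.ne'
  obtain ⟨e⟩ := Cardinal.eq.1 hcard
  classical
  refine ⟨fun a => if h : a ∈ A then (e ⟨a, h⟩).2 else ⟨0, hθ⟩, fun r α hα => ?_⟩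
  by_contra! hcon
  have hinj : Function.Injective
      (fun x : Iio κ.ord => (⟨(e.symm (x, r)).1, by
        by_contra hx
        refine hcon _ (e.symm (x, r)).2 (not_le.1 hx) ?_
        simp⟩ : Iic α)) := by
    intro x y hxy
    have h1 : (e.symm (x, r)).1 = (e.symm (y, r)).1 := congrArg (fun z : Iic α => z.1) hxy
    exact congrArg Prod.fst (e.symm.injective (Subtype.ext h1))
  have hle := mk_le_of_injective hinj
  rw [← Order.Iio_succ, mk_Iio_ordinal, mk_Iio_ordinal, card_ord, Cardinal.lift_le] at hle
  have : Order.succ α < κ.ord := (isSuccLimit_ord hκ).succ_lt hα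
  exact hle.not_gt (lt_ord.1 this)

/-- `C` has no points in an interval `(μ, δ]` ending in `δ`. -/
def HasGap (C : Set Ordinal.{u}) (δ : Ordinal.{u}) : Prop :=
  ∃ μ < δ, ∀ c ∈ C, c ≤ δ → c ≤ μ

/-- Use the successors of a cofinal ω-sequence: only finitely many values lie below a limit `δ < β`,
and `δ` itself is not a successor. -/
theorem exists_unbounded_hasGap_of_cof_eq_aleph0 {β : Ordinal.{u}} (hβ : β.cof = ℵ₀) :
    ∃ C ⊆ Iio β, (∀ α < β, ∃ c ∈ C, α < c) ∧
      ∀ δ < β, IsSuccLimit δ → HasGap C δ := by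
  have hlim : IsSuccLimit β := Ordinal.one_lt_cof_iff.1 (hβ ▸ one_lt_aleph0)
  have hcof : Order.cof (Iio β) = ℵ₀ := by
    rw [Ordinal.cof_Iio, ← Ordinal.lift_cof, hβ, lift_aleph0]
  obtain ⟨s, hs, hs'⟩ := Order.exists_cof_eq (Iio β)
  rw [hcof] at hs'
  have hne : Nonempty (Iio β) := ⟨⟨0, hlim.bot_lt⟩⟩
  obtain ⟨f, hf⟩ := (le_aleph0_iff_set_countable.1 hs'.le).exists_eq_range hs.nonempty
  let g : ℕ → Ordinal.{u} := partialSups (fun n => (f n).1)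
  have hgβ : ∀ n, g n < β := fun n => by
    obtain ⟨m, -, hm⟩ := exists_partialSups_eq (fun n => (f n).1) n
    exact hm.trans_lt (f m).2
  have hgm : Monotone g := (partialSups (fun n => (f n).1)).monotone
  have hgc : ∀ α < β, ∃ n, α ≤ g n := fun α hα => by
    obtain ⟨b, hb, hab⟩ := hs ⟨α, hα⟩
    rw [hf] at hb
    obtain ⟨n, rfl⟩ := hb
    exact ⟨n, le_trans hab (le_partialSups (fun n => (f n).1) n)⟩
  refine ⟨range fun n => Order.succ (g n), ?_, fun α hα => ?_, fun δ hδ hδl => ?_⟩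
  · rintro _ ⟨n, rfl⟩
    exact hlim.succ_lt (hgβ n)
  · obtain ⟨n, hn⟩ := hgc α hα
    exact ⟨_, ⟨n, rfl⟩, Order.lt_succ_of_le hn⟩
  · classical
    have hex : ∃ n, δ ≤ g n := hgc δ hδ
    rcases hN : Nat.find hex with _ | N
    · refine ⟨0, hδl.bot_lt, ?_⟩
      rintro _ ⟨n, rfl⟩ hc
      have h0 := Nat.find_spec hex
      rw [hN] at h0
      exact absurd (Order.succ_le_iff.1 hc) (h0.trans (hgm (Nat.zero_le n))).not_gt
    · have hlt : g N < δ := not_le.1 (Nat.find_min hex (by omega))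
      refine ⟨Order.succ (g N), hδl.succ_lt hlt, ?_⟩
      rintro _ ⟨n, rfl⟩ hc
      have h1 := Nat.find_spec hex
      rw [hN] at h1
      apply Order.succ_le_succ
      apply hgm
      by_contra! hn
      exact absurd (Order.succ_le_iff.1 hc) (h1.trans (hgm hn)).not_gt

/-- A club of `β` disjoint from `S` works: being closed and omitting `δ ∈ S`, it cannot accumulate
at `δ`. -/
theorem exists_unbounded_hasGap_of_not_stationaryIn {S : Set Ordinal.{u}} {β : Ordinal.{u}}
    (hβ : IsSuccLimit β) (h : ¬ StationaryIn S β) :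
    ∃ C ⊆ Iio β, (∀ α < β, ∃ c ∈ C, α < c) ∧ ∀ δ < β, δ ∈ S → 0 < δ → HasGap C δ := by
  obtain ⟨t, ht, hd⟩ := not_isStationary_iff.1 h
  refine ⟨Subtype.val '' t, ?_, fun α hα => ?_, fun δ hδ hδS hδ0 => ?_⟩
  · rintro _ ⟨x, -, rfl⟩
    exact x.2
  · obtain ⟨b, hb, hab⟩ := ht.isCofinal ⟨Order.succ α, hβ.succ_lt hα⟩
    exact ⟨b, ⟨b, hb, rfl⟩, Order.succ_le_iff.1 hab⟩
  · have hδt : (⟨δ, hδ⟩ : Iio β) ∉ t := fun h' => Set.disjoint_left.1 hd hδS h'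
    by_cases hne : {x ∈ t | x.1 ≤ δ}.Nonempty
    · obtain ⟨m, hm, hmin⟩ := WellFounded.has_min (wellFounded_lt (α := Iio β))
        (upperBounds {x ∈ t | x.1 ≤ δ}) ⟨⟨δ, hδ⟩, fun x hx => hx.2⟩
      have hlub : IsLUB {x ∈ t | x.1 ≤ δ} m := ⟨hm, fun y hy => not_lt.1 (hmin y hy)⟩
      have hmt : m ∈ t := ht.isLUB_mem (fun x hx => hx.1) hne hlub
      have hmδ : m ≤ ⟨δ, hδ⟩ := hlub.2 fun x hx => hx.2
      refine ⟨m, lt_of_le_of_ne hmδ fun e => hδt ((Subtype.ext e : m = ⟨δ, hδ⟩) ▸ hmt), ?_⟩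
      rintro _ ⟨x, hx, rfl⟩ hxδ
      exact hm ⟨hx, hxδ⟩
    · refine ⟨0, hδ0, ?_⟩
      rintro _ ⟨x, hx, rfl⟩ hxδ
      exact absurd ⟨x, hx, hxδ⟩ hne

/-- The only direct use of non-reflection, needed just for uncountable cofinality. -/
theorem NonReflecting.exists_unbounded_hasGap {S : Set Ordinal.{u}} {κ : Ordinal.{u}}
    (hS : NonReflecting S κ) {β : Ordinal.{u}} (hβκ : β < κ) (hβ : IsSuccLimit β) :
    ∃ C ⊆ Iio β, (∀ α < β, ∃ c ∈ C, α < c) ∧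
      ∀ δ < β, δ ∈ S → IsSuccLimit δ → HasGap C δ := by
  rcases (Ordinal.aleph0_le_cof_iff.2 (Ordinal.one_lt_cof_iff.2 hβ)).eq_or_lt with h | h
  · obtain ⟨C, h1, h2, h3⟩ := exists_unbounded_hasGap_of_cof_eq_aleph0 h.symm
    exact ⟨C, h1, h2, fun δ hδ _ hl => h3 δ hδ hl⟩
  · obtain ⟨C, h1, h2, h3⟩ := exists_unbounded_hasGap_of_not_stationaryIn hβ (hS β hβκ h)
    exact ⟨C, h1, h2, fun δ hδ hδS hl => h3 δ hδ hδS hl.bot_lt⟩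

/-- Every set unbounded in `δ` contains a set unbounded in `δ` that does not accumulate at points of `S`. -/
theorem NonReflecting.exists_ladder {S : Set Ordinal.{u}} {κ : Ordinal.{u}}
    (hS : NonReflecting S κ) {δ : Ordinal.{u}} (hδκ : δ < κ) (hδ : IsSuccLimit δ)
    {D : Set Ordinal.{u}} (hDc : ∀ α < δ, ∃ a ∈ D, α < a) :
    ∃ B ⊆ D, (∀ α < δ, ∃ b ∈ B, α < b) ∧
      ∀ ε < δ, ε ∈ S → IsSuccLimit ε → ∃ μ < ε, ∀ b ∈ B, b < ε → b ≤ μ := by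
  obtain ⟨C, hCδ, hC, hgap⟩ := hS.exists_unbounded_hasGap hδκ hδ
  -- Round each point of `C` up to `D`. If `D` has a point `b` in `[μ, ε)`, rounded points below `ε`
  -- come from `c ≤ μ` and are at most `b`; otherwise `D` has no points there at all.
  refine ⟨{x | ∃ c ∈ C, IsLeast {a ∈ D | c ≤ a} x}, ?_, fun α hα => ?_, fun ε hε hεS hεl => ?_⟩
  · rintro x ⟨c, -, hx⟩
    exact hx.1.1
  · obtain ⟨c, hc, hαc⟩ := hC α hα
    obtain ⟨a, ha, hca⟩ := hDc c (hCδ hc)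
    have hne : {a ∈ D | c ≤ a}.Nonempty := ⟨a, ha, hca.le⟩
    exact ⟨sInf {a ∈ D | c ≤ a}, ⟨c, hc, csInf_mem hne, fun y hy => csInf_le' hy⟩,
      hαc.trans_le (csInf_mem hne).2⟩
  · obtain ⟨μ, hμ, hμC⟩ := hgap ε hε hεS hεl
    by_cases hb : ∃ b ∈ D, μ ≤ b ∧ b < ε
    · obtain ⟨b, hbD, hμb, hbε⟩ := hb
      refine ⟨b, hbε, ?_⟩
      rintro x ⟨c, hc, hx⟩ hxε
      exact hx.2 ⟨hbD, (hμC c hc (hx.1.2.trans hxε.le)).trans hμb⟩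
    · push Not at hb
      refine ⟨μ, hμ, ?_⟩
      rintro x ⟨c, -, hx⟩ hxε
      by_contra! hlt
      exact (hb x hx.1.1 hlt.le).not_gt hxε

/-- Below any `β < κ`, a ladder system on a non-reflecting set can be made disjoint by
removing a proper initial segment of each ladder. -/
theorem NonReflecting.exists_disjointing {S : Set Ordinal.{u}} {κ : Ordinal.{u}}
    (hS : NonReflecting S κ) {B : Ordinal.{u} → Set Ordinal.{u}} (hBδ : ∀ δ, B δ ⊆ Iio δ)
    (hB : ∀ δ ∈ S, IsSuccLimit δ → ∀ ε < δ, ε ∈ S → IsSuccLimit ε →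
      ∃ μ < ε, ∀ b ∈ B δ, b < ε → b ≤ μ) (β : Ordinal.{u}) (hβ : β < κ) :
    ∃ f : Ordinal.{u} → Ordinal.{u}, (∀ δ < β, δ ∈ S → IsSuccLimit δ → f δ < δ) ∧
      ∀ δ < β, δ ∈ S → IsSuccLimit δ → ∀ ε < δ, ε ∈ S → IsSuccLimit ε →
        ∀ x, x ∈ B δ → f δ < x → x ∈ B ε → f ε < x → False := by
  classical
  induction β using Ordinal.limitRecOn with
  | zero => exact ⟨fun _ => 0, fun δ hδ => absurd hδ not_lt_bot, fun δ hδ => absurd hδ not_lt_bot⟩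
  | add_one γ ih =>
    obtain ⟨f, hf, hfd⟩ := ih ((lt_add_one γ).trans hβ)
    by_cases hγ : γ ∈ S ∧ IsSuccLimit γ
    · have hμ : ∀ ε, ∃ μ, ε < γ → ε ∈ S → IsSuccLimit ε →
          μ < ε ∧ ∀ b ∈ B γ, b < ε → b ≤ μ := fun ε => by
        by_cases h : ε < γ ∧ ε ∈ S ∧ IsSuccLimit ε
        · obtain ⟨μ, h1, h2⟩ := hB γ hγ.1 hγ.2 ε h.1 h.2.1 h.2.2
          exact ⟨μ, fun _ _ _ => ⟨h1, h2⟩⟩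
        · exact ⟨0, fun a b c => absurd ⟨a, b, c⟩ h⟩
      choose μ hμ using hμ
      -- The new ladder `B γ` is left essentially whole; each earlier ladder is cut above the bound
      -- of `B γ` below its index.
      refine ⟨fun δ => if δ = γ then 0 else max (f δ) (μ δ), fun δ hδ hδS hδl => ?_,
        fun δ hδ hδS hδl ε hε hεS hεl x hxδ hδx hxε hεx => ?_⟩
      · beta_reduce
        split_ifs with h
        · exact hδl.bot_lt
        · have hlt : δ < γ := lt_of_le_of_ne (Order.lt_add_one_iff.1 hδ) h
          exact max_lt (hf δ hlt hδS hδl) (hμ δ hlt hδS hδl).1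
      · have hεγ : ε < γ := hε.trans_le (Order.lt_add_one_iff.1 hδ)
        beta_reduce at hδx hεx
        rw [if_neg hεγ.ne] at hεx
        have hxε' : x < ε := hBδ ε hxε
        by_cases h : δ = γ
        · subst h
          exact ((hμ ε hεγ hεS hεl).2 x hxδ hxε').not_gt ((le_max_right _ _).trans_lt hεx)
        · rw [if_neg h] at hδx
          have hlt : δ < γ := lt_of_le_of_ne (Order.lt_add_one_iff.1 hδ) h
          exact hfd δ hlt hδS hδl ε hε hεS hεl x hxδ ((le_max_left _ _).trans_lt hδx) hxε
            ((le_max_left _ _).trans_lt hεx)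
    · have hne : ∀ δ < γ + 1, δ ∈ S → IsSuccLimit δ → δ < γ := fun δ hδ h1 h2 =>
        lt_of_le_of_ne (Order.lt_add_one_iff.1 hδ) fun e => hγ (e ▸ ⟨h1, h2⟩)
      exact ⟨f, fun δ hδ h1 h2 => hf δ (hne δ hδ h1 h2) h1 h2,
        fun δ hδ h1 h2 => hfd δ (hne δ hδ h1 h2) h1 h2⟩
  | limit β hlim ih =>
    obtain ⟨C, hCβ, hC, hgap⟩ := hS.exists_unbounded_hasGap hβ hlim
    have hF : ∀ γ, ∃ f : Ordinal.{u} → Ordinal.{u}, γ < β →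
        (∀ δ < γ, δ ∈ S → IsSuccLimit δ → f δ < δ) ∧
        ∀ δ < γ, δ ∈ S → IsSuccLimit δ → ∀ ε < δ, ε ∈ S → IsSuccLimit ε →
          ∀ x, x ∈ B δ → f δ < x → x ∈ B ε → f ε < x → False := fun γ => by
      by_cases h : γ < β
      · obtain ⟨f, hf⟩ := ih γ h (h.trans hβ)
        exact ⟨f, fun _ => hf⟩
      · exact ⟨id, fun h' => absurd h' h⟩
    choose F hF using hF
    have hμ : ∀ ε, ∃ μ, ε < β → ε ∈ S → IsSuccLimit ε →
        μ < ε ∧ ∀ c ∈ C, c ≤ ε → c ≤ μ := fun ε => by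
      by_cases h : ε < β ∧ ε ∈ S ∧ IsSuccLimit ε
      · obtain ⟨μ, h1, h2⟩ := hgap ε h.1 h.2.1 h.2.2
        exact ⟨μ, fun _ _ _ => ⟨h1, h2⟩⟩
      · exact ⟨0, fun a b c => absurd ⟨a, b, c⟩ h⟩
    choose μ hμ using hμ
    have hnext : ∀ δ, δ < β → sInf {c ∈ C | δ < c} ∈ C ∧ δ < sInf {c ∈ C | δ < c} :=
      fun δ hδ => by
        obtain ⟨c, hc⟩ := hC δ hδ
        exact csInf_mem (s := {c ∈ C | δ < c}) ⟨c, hc⟩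
    -- Treat `δ` by the function for the next point of `C` above it, cutting also at the gap. If `ε
    -- < δ` have different next points, one lies in `(ε, δ]`, hence below `μ δ`, so the trimmed `B
    -- δ` lies above `ε` and misses `B ε`.
    refine ⟨fun δ => max (F (sInf {c ∈ C | δ < c}) δ) (μ δ), fun δ hδ hδS hδl => ?_,
      fun δ hδ hδS hδl ε hε hεS hεl x hxδ hδx hxε hεx => ?_⟩
    · exact max_lt ((hF _ (hCβ (hnext δ hδ).1)).1 δ (hnext δ hδ).2 hδS hδl) (hμ δ hδ hδS hδl).1
    · have hεβ := hε.trans hδ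
      have hn := hnext ε hεβ
      by_cases hle : sInf {c ∈ C | ε < c} ≤ δ
      · have h1 := (hμ δ hδ hδS hδl).2 _ hn.1 hle
        have h2 : x < ε := hBδ ε hxε
        exact absurd (h2.trans (hn.2.trans_le h1)) ((le_max_right _ _).trans_lt hδx).le.not_gt
      · push Not at hle
        have heq : sInf {c ∈ C | ε < c} = sInf {c ∈ C | δ < c} := by
          apply le_antisymm
          · exact csInf_le' ⟨(hnext δ hδ).1, hε.trans (hnext δ hδ).2⟩
          · exact csInf_le' ⟨hn.1, hle⟩
        refine (hF _ (hCβ (hnext δ hδ).1)).2 δ (hnext δ hδ).2 hδS hδl ε hε hεS hεl x hxδ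
          ((le_max_left _ _).trans_lt hδx) hxε ?_
        rw [← heq]
        exact (le_max_left _ _).trans_lt hεx

end HalpernLauchli

/-! ### Branches through suitable trees -/

namespace HalpernLauchli

open Order Set

/-- The node of length `α` given by the restriction of a function on all ordinals. -/
def toNode (α : Ordinal.{u}) (g : Ordinal.{u} → Bool) : Node.{u} := ⟨α, fun x => g x.1⟩

open Classical in
/-- The extension of a binary sequence by zeros. -/
noncomputable def BinSeq.extend {α : Ordinal.{u}} (η : BinSeq α) : Ordinal.{u} → Bool :=
  fun x => if h : x < α then η ⟨x, h⟩ else false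

theorem BinSeq.extend_of_lt {α : Ordinal.{u}} (η : BinSeq α) {x : Ordinal.{u}} (h : x < α) :
    η.extend x = η ⟨x, h⟩ := dif_pos h

theorem toNode_extend {α : Ordinal.{u}} (η : BinSeq α) : toNode α η.extend = ⟨α, η⟩ := by
  unfold toNode
  congr 1
  funext x
  exact η.extend_of_lt x.2

theorem toNode_congr {α : Ordinal.{u}} {g g' : Ordinal.{u} → Bool} (h : ∀ x < α, g x = g' x) :
    toNode α g = toNode α g' := by
  unfold toNode
  congr 1
  funext x
  exact h x.1 x.2

theorem isInit_toNode {α β : Ordinal.{u}} (h : α ≤ β) {g g' : Ordinal.{u} → Bool}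
    (hg : ∀ x < α, g x = g' x) : Node.IsInit (toNode α g) (toNode β g') :=
  ⟨h, funext fun x => (hg x.1 x.2).symm⟩

theorem snoc_eq {α : Ordinal.{u}} {g g' : Ordinal.{u} → Bool} (hg : ∀ x < α, g x = g' x) :
    (⟨α + 1, BinSeq.snoc (fun x : Iio α => g x.1) (g' α)⟩ : Node.{u}) = toNode (α + 1) g' := by
  unfold toNode
  congr 1
  funext x
  unfold BinSeq.snoc
  split_ifs with h
  · exact hg x.1 h
  · rw [le_antisymm (Order.lt_add_one_iff.1 x.2) (not_lt.1 h)]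

section

variable {κ : Cardinal.{u}} {T : Set Node.{u}} {A : Set Ordinal.{u}}

theorem IsSuitable.mem_of_le (hT : IsSuitable κ T A) {α β : Ordinal.{u}}
    {g : Ordinal.{u} → Bool} (h : toNode β g ∈ T) (hαβ : α ≤ β) : toNode α g ∈ T :=
  hT.regular.init_mem _ _ h (isInit_toNode hαβ fun _ _ => rfl)

theorem IsSuitable.mem_succ (hT : IsSuitable κ T A) {α : Ordinal.{u}} (hα : α ∈ A)
    {g g' : Ordinal.{u} → Bool} (h : toNode α g ∈ T) (hg : ∀ x < α, g x = g' x) :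
    toNode (α + 1) g' ∈ T :=
  snoc_eq hg ▸ (hT.split_iff α _ h).2 hα (g' α)

/-- Nodes of `T` of equal length that agree at the splitting levels are equal. -/
theorem IsSuitable.eq_of_eq_on_splitting (hT : IsSuitable κ T A) {β : Ordinal.{u}}
    {g g' : Ordinal.{u} → Bool} (h : toNode β g ∈ T) (h' : toNode β g' ∈ T)
    (hA : ∀ a < β, a ∈ A → g a = g' a) : ∀ x < β, g x = g' x := by
  intro x
  induction x using WellFoundedLT.induction with
  | ind x ih =>
    intro hx
    by_cases hxA : x ∈ A
    · exact hA x hx hxA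
    by_contra hne
    have hxβ : x + 1 ≤ β := Order.add_one_le_of_lt hx
    have hag : ∀ y < x, g y = g' y := fun y hy => ih y hy (hy.trans hx)
    -- A first disagreement at `x` puts both one-step extensions in `T`, forcing `x ∈ A`.
    refine hxA ((hT.split_iff x _ (hT.mem_of_le h hx.le)).1 fun i => ?_)
    have hi : i = g x ∨ i = g' x := by
      cases i <;> cases h1 : g x <;> cases h2 : g' x <;> simp_all
    rcases hi with rfl | rfl
    · rw [snoc_eq fun _ _ => rfl]
      exact hT.mem_of_le h hxβ
    · rw [snoc_eq hag]
      exact hT.mem_of_le h' hxβ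

/-- A node of `T` extends in `T` with prescribed values at the splitting levels. -/
theorem IsSuitable.exists_extension (hT : IsSuitable κ T A) {α : Ordinal.{u}}
    {g : Ordinal.{u} → Bool} (hg : toNode α g ∈ T) (f : Ordinal.{u} → Bool) (β : Ordinal.{u})
    (hαβ : α ≤ β) (hβ : β < κ.ord) :
    ∃ g', toNode β g' ∈ T ∧ (∀ x < α, g' x = g x) ∧ ∀ a ∈ A, α ≤ a → a < β → g' a = f a := by
  classical
  induction β using Ordinal.limitRecOn with
  | zero =>
    obtain rfl : α = 0 := le_antisymm hαβ bot_le
    exact ⟨g, hg, fun _ _ => rfl, fun a _ _ h => absurd h not_lt_bot⟩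
  | add_one γ ih =>
    rcases hαβ.eq_or_lt with rfl | hlt
    · exact ⟨g, hg, fun _ _ => rfl, fun a _ h h' => absurd h h'.not_ge⟩
    have hαγ := Order.lt_add_one_iff.1 hlt
    obtain ⟨g', hg', hgg, hA⟩ := ih hαγ ((lt_add_one γ).trans hβ)
    by_cases hγ : γ ∈ A
    · refine ⟨Function.update g' γ (f γ), hT.mem_succ hγ hg' fun x hx => ?_, fun x hx => ?_,
        fun a ha h1 h2 => ?_⟩
      · rw [Function.update_of_ne hx.ne]
      · rw [Function.update_of_ne (hx.trans_le hαγ).ne, hgg x hx]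
      · rcases (Order.lt_add_one_iff.1 h2).eq_or_lt with rfl | h3
        · simp
        · rw [Function.update_of_ne h3.ne, hA a ha h1 h3]
    · obtain ⟨⟨l, ν⟩, hν, ⟨hle, hinit⟩, hl⟩ := hT.regular.exists_extension _ hg' _ hβ
      obtain rfl : l = γ + 1 := hl.trans (max_eq_right (lt_add_one γ).le)
      have hag : ∀ x < γ, ν.extend x = g' x := fun x hx => by
        rw [ν.extend_of_lt (hx.trans (lt_add_one γ))]
        exact congrFun hinit ⟨x, hx⟩
      refine ⟨ν.extend, toNode_extend ν ▸ hν, fun x hx => ?_, fun a ha h1 h2 => ?_⟩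
      · rw [hag x (hx.trans_le hαγ), hgg x hx]
      · have h3 : a < γ := lt_of_le_of_ne (Order.lt_add_one_iff.1 h2) fun e => hγ (e ▸ ha)
        rw [hag a h3, hA a ha h1 h3]
  | limit β hlim ih =>
    rcases hαβ.eq_or_lt with rfl | hlt
    · exact ⟨g, hg, fun _ _ => rfl, fun a _ h h' => absurd h h'.not_ge⟩
    have hG : ∀ γ, ∃ g', α ≤ γ → γ < β → toNode γ g' ∈ T ∧ (∀ x < α, g' x = g x) ∧
        ∀ a ∈ A, α ≤ a → a < γ → g' a = f a := fun γ => by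
      by_cases h : α ≤ γ ∧ γ < β
      · obtain ⟨g', h'⟩ := ih γ h.2 h.1 (h.2.trans hβ)
        exact ⟨g', fun _ _ => h'⟩
      · exact ⟨g, fun a b => absurd ⟨a, b⟩ h⟩
    choose G hG using hG
    -- Extensions chosen independently cohere, since values at splitting levels determine a node of
    -- `T`.
    have hcoh : ∀ γ γ', α ≤ γ → γ ≤ γ' → γ' < β → ∀ x < γ, G γ x = G γ' x := by
      intro γ γ' h1 h2 h3
      obtain ⟨p1, p2, p3⟩ := hG γ h1 (h2.trans_lt h3)
      obtain ⟨q1, q2, q3⟩ := hG γ' (h1.trans h2) h3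
      refine hT.eq_of_eq_on_splitting p1 (hT.mem_of_le q1 h2) fun a ha haA => ?_
      rcases lt_or_ge a α with h | h
      · rw [p2 a h, q2 a h]
      · rw [p3 a haA h ha, q3 a haA h (ha.trans_le h2)]
    let g' : Ordinal.{u} → Bool := fun x => if x < α then g x else G (x + 1) x
    have hg' : ∀ γ, α ≤ γ → γ < β → ∀ x < γ, g' x = G γ x := by
      intro γ h1 h2 x hx
      by_cases h : x < α
      · simp only [g', if_pos h]
        exact ((hG γ h1 h2).2.1 x h).symm
      · simp only [g', if_neg h]
        exact hcoh (x + 1) γ ((not_lt.1 h).trans (lt_add_one x).le) (Order.add_one_le_of_lt hx) h2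
          x (lt_add_one x)
    refine ⟨g', hT.regular.limit_mem β hβ hlim _ fun γ hγ => ?_, fun x hx => if_pos hx,
      fun a ha h1 h2 => ?_⟩
    · change toNode γ g' ∈ T
      rcases le_total α γ with h | h
      · rw [toNode_congr (hg' γ h hγ)]
        exact (hG γ h hγ).1
      · rw [toNode_congr (g' := g) fun x hx => if_pos (hx.trans_le h)]
        exact hT.mem_of_le hg h
    · have h3 : a + 1 < β := hlim.add_one_lt h2
      have h4 : α ≤ a + 1 := h1.trans (lt_add_one a).le
      rw [hg' (a + 1) h4 h3 a (lt_add_one a)]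
      exact (hG (a + 1) h4 h3).2.2 a ha h1 (lt_add_one a)

end

end HalpernLauchli

/-! ### Colourings, guessing and comparison of cones -/

namespace HalpernLauchli

open Cardinal Order Set

theorem injective_fin_two {X : Type*} {v : Fin 2 → X} (h : v 0 ≠ v 1) : Function.Injective v := by
  intro l m hlm
  fin_cases l <;> fin_cases m
  · rfl
  · exact absurd hlm h
  · exact absurd hlm.symm h
  · rfl

/-- A partial colouring of increasing pairs extends to a colouring of unordered pairs. -/
theorem exists_pair_colouring {X C : Type*} [Nonempty C] (lt : X → X → Prop) [IsWellOrder X lt]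
    (R : X → X → C → Prop) (hR : ∀ x y r r', R x y r → R x y r' → r = r') :
    ∃ c : Set.powersetCard X 2 → C, ∀ (ν : Fin 2 ↪ X) (r : C), lt (ν 0) (ν 1) →
      R (ν 0) (ν 1) r → c (Set.powersetCard.ofFinEmb 2 X ν) = r := by
  have key : ∀ s : Set.powersetCard X 2, ∃ d : C, ∀ (ν : Fin 2 ↪ X) (r : C),
      Set.powersetCard.ofFinEmb 2 X ν = s → lt (ν 0) (ν 1) → R (ν 0) (ν 1) r → d = r := by
    intro s
    by_cases h : ∃ (ν : Fin 2 ↪ X) (r : C),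
      Set.powersetCard.ofFinEmb 2 X ν = s ∧ lt (ν 0) (ν 1) ∧ R (ν 0) (ν 1) r
    · obtain ⟨ν, r, hs, hlt, hr⟩ := h
      refine ⟨r, fun ν' r' hs' hlt' hr' => ?_⟩
      -- An unordered pair has only one increasing enumeration.
      have hmem : ∀ i, ν' i = ν 0 ∨ ν' i = ν 1 := fun i => by
        have : ν' i ∈ Set.powersetCard.ofFinEmb 2 X ν := by
          rw [hs, ← hs', Set.powersetCard.mem_ofFinEmb_iff_mem_range]
          exact ⟨i, rfl⟩
        rw [Set.powersetCard.mem_ofFinEmb_iff_mem_range] at this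
        obtain ⟨j, hj⟩ := this
        fin_cases j
        · exact Or.inl hj.symm
        · exact Or.inr hj.symm
      have h01 : ν' 0 = ν 0 ∧ ν' 1 = ν 1 := by
        rcases hmem 0 with h0 | h0 <;> rcases hmem 1 with h1 | h1
        · exact absurd (h0.trans h1.symm) (by simp)
        · exact ⟨h0, h1⟩
        · rw [h0, h1] at hlt'
          exact absurd hlt' (asymm_of lt hlt)
        · exact absurd (h0.trans h1.symm) (by simp)
      rw [h01.1, h01.2] at hr'
      exact hR _ _ _ _ hr hr'
    · exact ⟨Classical.arbitrary C, fun ν r h1 h2 h3 => absurd ⟨ν, r, h1, h2, h3⟩ h⟩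
  choose c hc using key
  exact ⟨c, fun ν r h1 h2 => hc _ ν r rfl h1 h2⟩

/-- There is a colouring of functions that reads off the colour of the last point of `D`
where the function is nonzero. -/
theorem exists_last_colouring {C : Type*} [Nonempty C] (D : Set Ordinal.{u})
    (h : Ordinal.{u} → C) :
    ∃ g : (Ordinal.{u} → Bool) → C, ∀ y, ∀ a ∈ D, y a = true →
      (∀ b ∈ D, a < b → y b = false) → g y = h a := by
  have key : ∀ y : Ordinal.{u} → Bool, ∃ d : C, ∀ a ∈ D, y a = true →
      (∀ b ∈ D, a < b → y b = false) → d = h a := by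
    intro y
    by_cases hy : ∃ a ∈ D, y a = true ∧ ∀ b ∈ D, a < b → y b = false
    · obtain ⟨a, ha, hya, hl⟩ := hy
      refine ⟨h a, fun a' ha' hya' hl' => ?_⟩
      rcases lt_trichotomy a a' with hlt | rfl | hlt
      · simp [hl a' ha' hlt] at hya'
      · rfl
      · simp [hl' a ha hlt] at hya
    · exact ⟨Classical.arbitrary C, fun a h1 h2 h3 => absurd ⟨a, h1, h2, h3⟩ hy⟩
  choose g hg using key
  exact ⟨g, hg⟩

/-- For every set `A` of full size, the diamond sequence guesses `A` at a limit `δ` at which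
`A` can be coloured with every colour appearing cofinally. -/
theorem exists_guess {κ : Cardinal.{u}} (hκ : κ.IsRegular) (hκ' : ℵ₀ < κ)
    {S : Set Ordinal.{u}} {D : Ordinal.{u} → Set Ordinal.{u}}
    (hD : ∀ X ⊆ Iio κ.ord, StationaryIn {α | α ∈ S ∧ X ∩ Iio α = D α} κ.ord)
    {θ : Ordinal.{u}} (hθ : 0 < θ) (hθκ : θ < κ.ord) {A : Set Ordinal.{u}} (hAκ : A ⊆ Iio κ.ord)
    (hA : #A = Cardinal.lift.{u + 1} κ) :
    ∃ δ < κ.ord, δ ∈ S ∧ IsSuccLimit δ ∧ A ∩ Iio δ = D δ ∧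
      ∃ h : Ordinal.{u} → Iio θ, ∀ r, ∀ α < δ, ∃ a ∈ D δ, α < a ∧ h a = r := by
  obtain ⟨h, hh⟩ := exists_cofinal_colouring hκ.aleph0_le hA hθ hθκ
  have hlim : IsSuccLimit κ.ord := isSuccLimit_ord hκ.aleph0_le
  have : NoMaxOrder (Iio κ.ord) := ⟨fun a => ⟨⟨Order.succ a.1, hlim.succ_lt a.2⟩,
    Order.lt_succ a.1⟩⟩
  have hcof : ℵ₀ < Order.cof (Iio κ.ord) := by
    rw [cof_Iio_ord hκ, ← lift_aleph0.{u + 1, u}, Cardinal.lift_lt]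
    exact hκ'
  -- The limit points of each colour class form a club; fewer than `κ` of them intersect in a club,
  -- which meets the set of correct guesses.
  have hclub := IsClub.iInter (ι := Iio θ) hcof.ne'
    (f := fun r => {d : Iio κ.ord | (∃ a, a < d) ∧
      ∀ a < d, ∃ b ∈ {x : Iio κ.ord | x.1 ∈ A ∧ h x.1 = r}, a < b ∧ b < d})
    (by
      rw [cof_Iio_ord hκ, mk_Iio_ordinal, Cardinal.lift_id, Cardinal.lift_id, Cardinal.lift_lt]
      exact lt_ord.1 hθκ)
    (fun r => isClub_limitPoints hcof fun x => by
      obtain ⟨a, ha, hxa, har⟩ := hh r x.1 x.2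
      exact ⟨⟨a, hAκ ha⟩, ⟨ha, har⟩, hxa.le⟩)
  obtain ⟨⟨δ, hδκ⟩, ⟨hδS, hδD⟩, hδE⟩ := hD A hAκ hclub
  rw [mem_iInter] at hδE
  replace hδD : A ∩ Iio δ = D δ := hδD
  refine ⟨δ, hδκ, hδS, ⟨?_, fun a ha => ?_⟩, hδD, h, fun r α hα => ?_⟩
  · obtain ⟨a, ha⟩ := (hδE ⟨0, hθ⟩).1
    exact not_isMin_of_lt (show a.1 < δ from ha)
  · obtain ⟨b, -, hab, hbδ⟩ := (hδE ⟨0, hθ⟩).2 ⟨a, ha.1.trans hδκ⟩ ha.1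
    exact ha.2 (show a < b.1 from hab) hbδ
  · obtain ⟨b, hb, hab, hbδ⟩ := (hδE r).2 ⟨α, hα.trans hδκ⟩ hα
    exact ⟨b.1, hδD ▸ ⟨hb.1, hbδ⟩, hab, hb.2⟩

/-- A choice of ladders inside the sets of a guessing sequence. -/
theorem NonReflecting.exists_ladder_system {S : Set Ordinal.{u}} {κ : Ordinal.{u}}
    (hS : NonReflecting S κ) (hSκ : S ⊆ Iio κ) {D : Ordinal.{u} → Set Ordinal.{u}}
    (hD : ∀ δ ∈ S, D δ ⊆ Iio δ) :
    ∃ B : Ordinal.{u} → Set Ordinal.{u}, (∀ δ, B δ ⊆ Iio δ) ∧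
      (∀ δ ∈ S, IsSuccLimit δ → ∀ ε < δ, ε ∈ S → IsSuccLimit ε →
        ∃ μ < ε, ∀ b ∈ B δ, b < ε → b ≤ μ) ∧
      ∀ δ ∈ S, IsSuccLimit δ → (∀ α < δ, ∃ a ∈ D δ, α < a) →
        B δ ⊆ D δ ∧ ∀ α < δ, ∃ b ∈ B δ, α < b := by
  have key : ∀ δ, ∃ B ⊆ Iio δ,
      (δ ∈ S → IsSuccLimit δ → ∀ ε < δ, ε ∈ S → IsSuccLimit ε →
        ∃ μ < ε, ∀ b ∈ B, b < ε → b ≤ μ) ∧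
      (δ ∈ S → IsSuccLimit δ → (∀ α < δ, ∃ a ∈ D δ, α < a) →
        B ⊆ D δ ∧ ∀ α < δ, ∃ b ∈ B, α < b) := by
    intro δ
    by_cases h : δ ∈ S ∧ IsSuccLimit δ ∧ ∀ α < δ, ∃ a ∈ D δ, α < a
    · obtain ⟨B, h1, h2, h3⟩ := hS.exists_ladder (hSκ h.1) h.2.1 h.2.2
      exact ⟨B, h1.trans (hD δ h.1), fun _ _ => h3, fun _ _ _ => ⟨h1, h2⟩⟩
    · refine ⟨∅, empty_subset _, fun _ _ ε _ _ hε => ⟨0, hε.bot_lt, by simp⟩,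
        fun a b c => absurd ⟨a, b, c⟩ h⟩
  choose B h1 h2 h3 using key
  exact ⟨B, h1, h2, h3⟩

/-- In one of the two orders, the least element of one set lies below all of the other. -/
theorem exists_lt_forall {X : Type*} (lt : X → X → Prop) [IsWellOrder X lt] (Y : Bool → Set X)
    (hY : ∀ i, (Y i).Nonempty) (hd : ∀ x, x ∈ Y false → x ∈ Y true → False) :
    ∃ i, ∃ x ∈ Y i, ∀ y ∈ Y (!i), lt x y := by
  have hwf : WellFounded lt := IsWellFounded.wf
  have hmin : ∀ i, ∃ x ∈ Y i, ∀ y ∈ Y i, ¬ lt y x := fun i => hwf.has_min (Y i) (hY i)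
  obtain ⟨x, hx, hxm⟩ := hmin false
  obtain ⟨y, hy, hym⟩ := hmin true
  have step : ∀ a b c, lt a b → ¬ lt c b → lt a c := fun a b c hab hcb => by
    rcases trichotomous_of lt b c with h | rfl | h
    · exact trans_of lt hab h
    · exact hab
    · exact absurd h hcb
  rcases trichotomous_of lt x y with h | rfl | h
  · exact ⟨false, x, hx, fun z hz => step x y z h (hym z hz)⟩
  · exact (hd x hx hy).elim
  · exact ⟨true, y, hy, fun z hz => step y x z h (hxm z hz)⟩

end HalpernLauchli

/-! ### The bad colouring and the contradiction -/

open HalpernLauchli Set Order in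
theorem theorem1p7 (κ : Cardinal.{u}) (hκ : κ.IsInaccessible)
    (S : Set Ordinal.{u}) (hSκ : S ⊆ Set.Iio κ.ord)
    (hS : HalpernLauchli.StationaryIn S κ.ord)
    (hSr : HalpernLauchli.NonReflecting S κ.ord)
    (hD : HalpernLauchli.Diamond κ.ord S)
    (θ : Ordinal.{u}) (hθ : 2 ≤ θ) (hθκ : θ < κ.ord) :
    ¬ HalpernLauchli.HLPlusBracket 2 θ κ := by
  have hreg := hκ.isRegular
  have hlim : IsSuccLimit κ.ord := Cardinal.isSuccLimit_ord hreg.aleph0_le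
  have hθ0 : 0 < θ := lt_of_lt_of_le (by simp) hθ
  have : Nonempty (Iio θ) := ⟨⟨0, hθ0⟩⟩
  obtain ⟨D, hDδ, hD⟩ := hD
  obtain ⟨B, hBδ, hBgap, hBD⟩ := hSr.exists_ladder_system hSκ hDδ
  have hf := fun β : Iio κ.ord =>
    -- `β + 1` rather than `β`, so that `δ = β` is covered.
    hSr.exists_disjointing hBδ hBgap (β.1 + 1) (hlim.add_one_lt β.2)
  choose f hfδ hfd using hf
  have hcol : ∀ δ, ∃ h : Ordinal.{u} → Iio θ,
      (∃ h : Ordinal.{u} → Iio θ, ∀ r, ∀ α < δ, ∃ a ∈ D δ, α < a ∧ h a = r) →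
        ∀ r, ∀ α < δ, ∃ a ∈ D δ, α < a ∧ h a = r := fun δ => by
    by_cases h : ∃ h : Ordinal.{u} → Iio θ, ∀ r, ∀ α < δ, ∃ a ∈ D δ, α < a ∧ h a = r
    · exact ⟨h.choose, fun _ => h.choose_spec⟩
    · exact ⟨fun _ => ⟨0, hθ0⟩, fun h' => absurd h' h⟩
  choose col hcol using hcol
  choose g hg using fun δ => exists_last_colouring (D δ) (col δ)
  let R : ∀ β : Iio κ.ord, BinSeq β.1 → BinSeq β.1 → Iio θ → Prop := fun β x y r =>
    ∃ δ ≤ β.1, δ ∈ S ∧ IsSuccLimit δ ∧ ∃ ξ ∈ B δ, f β δ < ξ ∧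
      (∀ z < ξ, x.extend z = y.extend z) ∧ x.extend ξ ≠ y.extend ξ ∧
      r = g δ y.extend
  have hR : ∀ β x y r r', R β x y r → R β x y r' → r = r' := by
    rintro β x y r r' ⟨δ, hδβ, hδS, hδl, ξ, hξ, hfξ, heq, hne, rfl⟩
      ⟨δ', hδβ', hδS', hδl', ξ', hξ', hfξ', heq', hne', rfl⟩
    obtain rfl : ξ = ξ' := by
      rcases lt_trichotomy ξ ξ' with h | h | h
      · exact absurd (heq' ξ h) hne
      · exact h
      · exact absurd (heq ξ' h) hne'
    rcases lt_trichotomy δ δ' with h | rfl | h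
    · exact (hfd β δ' (Order.lt_add_one_iff.2 hδβ') hδS' hδl' δ h hδS hδl ξ hξ' hfξ' hξ hfξ).elim
    · rfl
    · exact (hfd β δ (Order.lt_add_one_iff.2 hδβ) hδS hδl δ' h hδS' hδl' ξ hξ hfξ hξ' hfξ').elim
  choose c hc using fun β => exists_pair_colouring (WellOrderingRel (α := BinSeq β.1)) (R β) (hR β)
  intro hHL
  obtain ⟨T, A, hT, hTc⟩ := hHL (fun β => WellOrderingRel) (fun β => inferInstance) c
  obtain ⟨δ, hδκ, hδS, hδl, hδA, hδcol⟩ :=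
    exists_guess hreg hκ.aleph0_lt hD hθ0 hθκ hT.subset hT.card_eq
  have hδh := hcol δ hδcol
  obtain ⟨β, hβA, hδβ⟩ : ∃ β ∈ A, δ ≤ β := by
    obtain ⟨_, hh⟩ := exists_cofinal_colouring hreg.aleph0_le hT.card_eq hθ0 hθκ
    obtain ⟨a, ha, hδa, -⟩ := hh ⟨0, hθ0⟩ δ hδκ
    exact ⟨a, ha, hδa.le⟩
  have hβκ : β < κ.ord := hT.subset hβA
  obtain ⟨hBsub, hBcof⟩ := hBD δ hδS hδl fun α hα => by
    obtain ⟨a, ha, hαa, -⟩ := hδh ⟨0, hθ0⟩ α hα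
    exact ⟨a, ha, hαa⟩
  obtain ⟨ξ, hξB, hfξ⟩ := hBcof (f ⟨β, hβκ⟩ δ)
    (hfδ ⟨β, hβκ⟩ δ (Order.lt_add_one_iff.2 hδβ) hδS hδl)
  have hξA : ξ ∈ A := (hδA ▸ hBsub hξB : ξ ∈ A ∩ Iio δ).1
  have hξδ : ξ < δ := hBδ δ hξB
  have hξ1 : ξ + 1 < δ := hδl.add_one_lt hξδ
  obtain ⟨p, hp⟩ : ∃ p, toNode ξ p ∈ T := by
    obtain ⟨⟨l, η⟩, hη⟩ := hT.regular.nonempty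
    have h0 : toNode 0 η.extend ∈ T := hT.mem_of_le (toNode_extend η ▸ hη) bot_le
    obtain ⟨p, hp, -⟩ := hT.exists_extension h0 (fun _ => false) ξ bot_le (hξδ.trans hδκ)
    exact ⟨p, hp⟩
  classical
  let q : Bool → Ordinal.{u} → Bool := fun i => Function.update p ξ i
  have hq : ∀ i, toNode (ξ + 1) (q i) ∈ T := fun i =>
    hT.mem_succ hξA hp fun x hx => (Function.update_of_ne hx.ne _ _).symm
  have hqξ : ∀ i, q i ξ = i := fun i => Function.update_self _ _ _
  have hqlt : ∀ i, ∀ z < ξ, q i z = p z := fun i z hz => Function.update_of_ne hz.ne _ _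
  let Y : Bool → Set (BinSeq β) := fun i =>
    {x | (⟨β, x⟩ : Node.{u}) ∈ T ∧ ∀ z < ξ + 1, x.extend z = q i z}
  have hβ1 : ξ + 1 ≤ β := hξ1.le.trans hδβ
  have hext : ∀ i (v : Ordinal.{u} → Bool), ∃ x ∈ Y i, ∀ a ∈ A, ξ + 1 ≤ a → a < β →
      x.extend a = v a := fun i v => by
    obtain ⟨w, hw, hwq, hwv⟩ := hT.exists_extension (hq i) v β hβ1 hβκ
    have hwe : ∀ z < β, BinSeq.extend (fun x : Iio β => w x.1) z = w z := fun z hz =>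
      BinSeq.extend_of_lt _ hz
    exact ⟨fun x => w x.1, ⟨hw, fun z hz => (hwe z (hz.trans_le hβ1)).trans (hwq z hz)⟩,
      fun a ha h1 h2 => (hwe a h2).trans (hwv a ha h1 h2)⟩
  have hYne : ∀ i j, ∀ x ∈ Y i, ∀ y ∈ Y j, i ≠ j → x.extend ξ ≠ y.extend ξ := by
    intro i j x hx y hy hij
    rwa [hx.2 ξ (lt_add_one ξ), hy.2 ξ (lt_add_one ξ), hqξ, hqξ]
  -- This fixes the order of the two nodes and the smaller element `x` before the omitted colour `r`
  -- is known; only `y` depends on `r`.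
  obtain ⟨i, x, hx, hxlt⟩ := exists_lt_forall (WellOrderingRel (α := BinSeq β)) Y
    (fun i => (hext i fun _ => false).imp fun _ h => h.1)
    (fun x h1 h2 => hYne _ _ x h1 x h2 (by simp) rfl)
  let η : Fin 2 → BinSeq (ξ + 1) := fun l z => q (if l = 0 then i else !i) z.1
  have hηinj : Function.Injective η := injective_fin_two fun h => by
    have h' : q i ξ = q (!i) ξ := congrFun h ⟨ξ, lt_add_one ξ⟩
    rw [hqξ, hqξ] at h'
    exact Bool.not_ne_self i h'.symm
  obtain ⟨r, hr⟩ := hTc (ξ + 1) (hξ1.trans hδκ) η hηinj fun l => hq _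
  obtain ⟨a, haD, hξa, har⟩ := hδh r (ξ + 1) hξ1
  have haA : a ∈ A ∩ Iio δ := hδA ▸ haD
  -- Since `D δ = A ∩ δ` and `δ ≤ β`, `a` becomes the last point of `D δ` where `y` is 1, giving
  -- colour `r`.
  obtain ⟨y, hy, hyv⟩ := hext (!i) fun z => decide (z = a)
  have hxy : x ≠ y := fun e => hYne i (!i) x hx y hy (by simp) (e ▸ rfl)
  let ν : Fin 2 ↪ BinSeq β := ⟨![x, y], injective_fin_two hxy⟩
  have hinit : ∀ j, ∀ z ∈ Y j, Node.IsProperInit ⟨ξ + 1, fun t => q j t.1⟩ ⟨β, z⟩ := by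
    intro j z hz
    refine ⟨?_, fun e => ?_⟩
    · rw [← toNode_extend z]
      exact isInit_toNode hβ1 fun t ht => (hz.2 t ht).symm
    · exact (hξ1.trans_le hδβ).ne (congrArg Sigma.fst e)
  refine hr ⟨β, hβκ⟩ hβA ν (fun l => ?_) (fun l m hlm => ?_) ?_
  · fin_cases l
    · exact ⟨hinit i x hx, hx.1⟩
    · exact ⟨hinit (!i) y hy, hy.1⟩
  · obtain ⟨rfl, rfl⟩ : l = 0 ∧ m = 1 := by omega
    exact hxlt y hy
  · refine hc ⟨β, hβκ⟩ ν r (hxlt y hy) ⟨δ, hδβ, hδS, hδl, ξ, hξB, hfξ, fun z hz => ?_,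
      hYne i (!i) x hx y hy (by simp), ?_⟩
    · have hz1 := hz.trans (lt_add_one ξ)
      exact (hx.2 z hz1).trans ((hqlt i z hz).trans
        ((hqlt (!i) z hz).symm.trans (hy.2 z hz1).symm))
    · rw [← har]
      symm
      apply hg δ _ a haD
      · exact (hyv a haA.1 hξa.le (haA.2.trans_le hδβ)).trans (decide_eq_true rfl)
      · intro b hb hab
        have hbA : b ∈ A ∩ Iio δ := hδA ▸ hb
        exact (hyv b hbA.1 (hξa.trans hab).le (hbA.2.trans_le hδβ)).trans
          (decide_eq_false hab.ne')
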